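/- Let $\mathcal{M}$ be the class of Bernoulli two-armed bandit models, i.e. of all pairs $\nu=(\mathcal{B}(\mu_1),\mathcal{B}(\mu_2))$ of Bernoulli distributions with $\mu_1,\mu_2\in(0,1)$ and $\mu_1\neq\mu_2$; write $a^*$ for the arm with the larger mean. A strategy consists of a sampling rule $(A_t)_{t\ge 1}$, a stopping rule $\tau$ and a recommendation $\hat a\in\{1,2\}$. At each time $t$ it draws arm $A_t\in\{1,2\}$ and observes an independent sample $Z_t$ of $\nu_{A_t}$. With $\mathcal{F}_t=\sigma(A_1,Z_1,\dots,A_t,Z_t)$, the arm $A_t$ is $\mathcal{F}_{t-1}$-measurable, $\tau$ is a stopping time for $(\mathcal{F}_t)$ with $\mathbb{P}_\nu(\tau<\infty)=1$ for all $\nu\in\mathcal{M}$, and $\hat a$ is $\mathcal{F}_\tau$-measurable. For $\delta\in(0,1)$ a strategy is $\delta$-PAC if $\mathbb{P}_\nu(\hat a=a^*)\ge 1-\delta$ for every $\nu\in\mathcal{M}$. A family of strategies indexed by $t\in\mathbb{N}$, the $t$-th with $\tau=t$ almost surely under every $\nu\in\mathcal{M}$, is consistent if $p_t(\nu):=\mathbb{P}_\nu(\hat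 a\ne a^*)\to 0$ as $t\to\infty$ for every $\nu\in\mathcal{M}$. Define, with values in $[0,+\infty]$ and with $1/0=+\infty$, $1/\infty=0$, the fixed-confidence and the fixed-budget complexity of $\nu\in\mathcal{M}$ by $$\kappa_C(\nu)=\inf_{(\mathcal{A}_\delta)_{\delta\in(0,1)}:\ \mathcal{A}_\delta\ \delta\text{-PAC}}\ \limsup_{\delta\to 0}\frac{\mathbb{E}_\nu[\tau_\delta]}{\log(1/\delta)},\qquad \kappa_B(\nu)=\inf_{(\mathcal{A}_t)_t\ \text{consistent}}\Bigl(\limsup_{t\to\infty}-\frac1t\log p_t(\nu)\Bigr)^{-1},$$ where $\tau_\delta$ is the stopping rule of $\mathcal{A}_\delta$. Then $\kappa_C(\nu)>\kappa_B(\nu)$ for every $\nu\in\mathcal{M}$. -/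

import Mathlib

open MeasureTheory ProbabilityTheory Filter Topology
open scoped ENNReal

noncomputable section

namespace TwoArmedBandit

/-- A two-armed bandit model: a pair of probability distributions on the real line. -/
abbrev Model : Type := Fin 2 → ProbabilityMeasure ℝ

/-- The expectation of arm `a`. -/
def Model.mean (ν : Model) (a : Fin 2) : ℝ := ∫ x, x ∂(ν a : Measure ℝ)

/-- `a` is an arm with the highest expectation. -/
def Model.IsBestArm (ν : Model) (a : Fin 2) : Prop := ∀ b, ν.mean b ≤ ν.mean a

/-- The sample space. The real number `ω t a` is the draw that arm `a` would deliver if it were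
chosen in round `t`; rounds are numbered from `0`. Only `ω t (A t ω)` is ever observed. -/
abbrev Draws : Type := ℕ → Fin 2 → ℝ

/-- The law of the draws under the bandit model `ν`: all draws are independent, and those of
arm `a` have law `ν a`. -/
def Model.law (ν : Model) : Measure Draws :=
  Measure.infinitePi (fun _ : ℕ => Measure.pi (fun a : Fin 2 => (ν a : Measure ℝ)))

/-- The observation made in round `t` when the arms are chosen according to `A`. -/
def observation (A : ℕ → Draws → Fin 2) (t : ℕ) (ω : Draws) : ℝ := ω t (A t ω)

/-- The sigma-algebra generated by the arms chosen and the observations made in the first `t`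
rounds. -/
abbrev pastSigma (A : ℕ → Draws → Fin 2) (t : ℕ) : MeasurableSpace Draws :=
  ⨆ s : Fin t, MeasurableSpace.comap (fun ω => (A s ω, observation A s ω)) inferInstance

/-- A sampling rule: the arm chosen in each round is a function of what has been seen in the
rounds before it. -/
structure SamplingRule where
  /-- The arm chosen in round `t`. -/
  arm : ℕ → Draws → Fin 2
  /-- The choice is measurable with respect to the past. -/
  predictable : ∀ t, Measurable[pastSigma arm t] (arm t)

theorem measurable_observation {A : ℕ → Draws → Fin 2} {t : ℕ} (h : Measurable (A t)) :
    Measurable (observation A t) := by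
  have h2 : Measurable (fun p : (Fin 2 → ℝ) × Fin 2 => p.1 p.2) :=
    measurable_from_prod_countable_left fun a => measurable_pi_apply a
  exact h2.comp ((measurable_pi_apply t).prodMk h)

theorem SamplingRule.measurable_arm (S : SamplingRule) (t : ℕ) : Measurable (S.arm t) := by
  induction t using Nat.strong_induction_on with
  | _ t ih =>
    refine (S.predictable t).mono (iSup_le fun s => ?_) le_rfl
    exact ((ih s s.2).prodMk (measurable_observation (ih s s.2))).comap_le

/-- The filtration of the information available after `t = 0, 1, 2, …` rounds. -/
def SamplingRule.filtration (S : SamplingRule) :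
    Filtration ℕ (inferInstance : MeasurableSpace Draws) where
  seq := pastSigma S.arm
  mono' := fun _ t hst => iSup_le fun i =>
    le_iSup (fun j : Fin t => MeasurableSpace.comap
      (fun ω => (S.arm j ω, observation S.arm j ω)) inferInstance) (Fin.castLE hst i)
  le' := fun _ => iSup_le fun s =>
    ((S.measurable_arm s).prodMk (measurable_observation (S.measurable_arm s))).comap_le

/-- A strategy on the class `M` of bandit models: a sampling rule, a stopping rule that is almost
surely finite under every model of `M`, and a recommendation that depends only on what has been
seen when the strategy stops. -/
structure Strategy (M : Set Model) extends SamplingRule where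
  /-- The number of rounds played. -/
  tau : Draws → ℕ∞
  isStoppingTime : IsStoppingTime toSamplingRule.filtration tau
  tau_finite : ∀ ν ∈ M, ∀ᵐ ω ∂ν.law, tau ω < ⊤
  /-- The arm recommended at the end. -/
  recommend : Draws → Fin 2
  measurable_recommend : Measurable[isStoppingTime.measurableSpace] recommend

namespace Strategy

variable {M : Set Model}

/-- The expected number of draws under `ν`. -/
def expectedDraws (S : Strategy M) (ν : Model) : ℝ≥0∞ := ∫⁻ ω, (S.tau ω : ℝ≥0∞) ∂ν.law

/-- The probability under `ν` that the recommended arm is not the best one. -/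
def errorProb (S : Strategy M) (ν : Model) : ℝ≥0∞ :=
  ν.law {ω | ¬ ν.IsBestArm (S.recommend ω)}

/-- Under every model of the class, the best arm is recommended with probability at least
`1 - δ`. -/
def IsPAC (S : Strategy M) (δ : ℝ) : Prop :=
  ∀ ν ∈ M, ENNReal.ofReal (1 - δ) ≤ ν.law {ω | ν.IsBestArm (S.recommend ω)}

end Strategy

/-- A fixed-confidence procedure: a `δ`-PAC strategy for each risk `δ` in `(0, 1)`. -/
structure FixedConfidenceProcedure (M : Set Model) where
  strategy : ℝ → Strategy M
  isPAC : ∀ δ ∈ Set.Ioo (0 : ℝ) 1, (strategy δ).IsPAC δ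

/-- A consistent fixed-budget procedure: for each budget `t` a strategy that makes exactly `t`
draws, such that the probability of error tends to `0` under every model of the class. -/
structure ConsistentProcedure (M : Set Model) where
  strategy : ℕ → Strategy M
  tau_eq : ∀ t, ∀ ν ∈ M, ∀ᵐ ω ∂ν.law, (strategy t).tau ω = t
  consistent : ∀ ν ∈ M, Tendsto (fun t => (strategy t).errorProb ν) atTop (𝓝 0)

/-- The fixed-confidence complexity of `ν` relative to the class `M`: the infimum of
`limsup_{δ → 0} E_ν[τ_δ] / log (1 / δ)`. -/
def fixedConfidenceComplexity (M : Set Model) (ν : Model) : ℝ≥0∞ :=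
  ⨅ P : FixedConfidenceProcedure M,
    limsup (fun δ : ℝ => (P.strategy δ).expectedDraws ν / ENNReal.ofReal (Real.log (1 / δ)))
      (𝓝[>] 0)

/-- The exponential rate `limsup_{t → ∞} - (1 / t) log p_t(ν)` of the probability of error, which
is nonnegative and possibly infinite. -/
def ConsistentProcedure.rate {M : Set Model} (P : ConsistentProcedure M) (ν : Model) : EReal :=
  limsup (fun t : ℕ => -ENNReal.log ((P.strategy t).errorProb ν) / (t : EReal)) atTop

/-- The fixed-budget complexity of `ν` relative to the class `M`: the infimum of the inverse of
the rate. Here the inverse of `0` is `∞` and the inverse of `∞` is `0`. -/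
def fixedBudgetComplexity (M : Set Model) (ν : Model) : ℝ≥0∞ :=
  ⨅ P : ConsistentProcedure M, ((P.rate ν).toENNReal)⁻¹

/-- The Bernoulli distribution on `{0, 1}` with mean `p`, as a distribution on the real line. -/
def bernoulli (p : unitInterval) : ProbabilityMeasure ℝ :=
  ⟨bernoulliMeasure (1 : ℝ) 0 p, inferInstance⟩

/-- The Bernoulli bandit models: means in `(0, 1)`, different from each other. -/
def bernoulliModels : Set Model :=
  {ν | ∃ p q : unitInterval, (p : ℝ) ∈ Set.Ioo 0 1 ∧ (q : ℝ) ∈ Set.Ioo 0 1 ∧ p ≠ q ∧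
    ν = ![bernoulli p, bernoulli q]}

end TwoArmedBandit

end

namespace TwoArmedBandit

/-! Let q < p be the two means and B = √(pq) + √((1-p)(1-q)) their Bhattacharyya coefficient. The
number 1/(-log B) separates the two complexities.

Fixed budget: sample both arms equally often and recommend the larger cumulated reward. Chernoff's
bound for the difference of the two sums, with the optimal exponent, gives an error of at most
B^(2⌊t/2⌋), so the rate is at least -log B (`fixedBudgetComplexity_bernoulli_le`).

Fixed confidence: let the arms with means p and q have means x < y in another model, where the order
is thus reversed. A `δ`-PAC strategy has to collect evidence of about log(1/δ) against it, and each
draw contributes at most max(KL(p,x), KL(q,y)) on average. Hence the complexity is at least 1/c for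
any c > 0 above this maximum (`IsPAC.ofReal_le_expectedDraws`,
`inv_le_fixedConfidenceComplexity_bernoulli`).

It remains to find such a c below -log B. Choose z between q and p with KL(p,z) = KL(q,z). If z = wp
+ (1-w)q, the common value is the Jensen-Shannon divergence with weight w, that is, the mutual
information between a label of prior w and one observation. It is at most 1 - B
(`jensenShannon_le`), and 1 - B < -log B because B < 1. The strict inequality leaves room to
separate z into x < y. -/

/-! ### Divergences between Bernoulli distributions -/

/-- The Kullback-Leibler divergence between two Bernoulli distributions. -/
noncomputable def bernoulliKL (p x : ℝ) : ℝ :=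
  p * Real.log (p / x) + (1 - p) * Real.log ((1 - p) / (1 - x))

/-- The Bhattacharyya coefficient of two Bernoulli distributions. -/
noncomputable def bhattacharyya (p q : ℝ) : ℝ := √(p * q) + √((1 - p) * (1 - q))

theorem bhattacharyya_pos {p q : ℝ} (hp : p ∈ Set.Ioo (0 : ℝ) 1) (hq : q ∈ Set.Ioo (0 : ℝ) 1) :
    0 < bhattacharyya p q := by
  have := mul_pos hp.1 hq.1
  unfold bhattacharyya
  positivity

theorem bhattacharyya_lt_one {p q : ℝ} (hp : p ∈ Set.Ioo (0 : ℝ) 1) (hq : q ∈ Set.Ioo (0 : ℝ) 1)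
    (hpq : p ≠ q) : bhattacharyya p q < 1 := by
  have h1 : √(p * q) < (p + q) / 2 := by
    rw [Real.sqrt_lt' (by linarith [hp.1, hq.1])]
    nlinarith [sq_pos_of_ne_zero (sub_ne_zero.2 hpq)]
  have h2 : √((1 - p) * (1 - q)) ≤ ((1 - p) + (1 - q)) / 2 := by
    rw [Real.sqrt_le_iff]
    exact ⟨by linarith [hp.2, hq.2], by nlinarith [sq_nonneg (p - q)]⟩
  unfold bhattacharyya
  linarith

/-- Here r stands for the posterior probability of a label with prior w. The second derivative is
nonpositive as soon as 4√(r(1-r))√(w(1-w)) ≤ 1, and each root is at most 1/2. -/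
theorem concaveOn_sqrt_div_sub_binEntropy {w : ℝ} (hw : w ∈ Set.Ioo (0 : ℝ) 1) :
    ConcaveOn ℝ (Set.Icc 0 1)
      (fun r => √(r * (1 - r)) / √(w * (1 - w)) - Real.binEntropy r) := by
  have hpos : ∀ r ∈ Set.Ioo (0 : ℝ) 1, 0 < r * (1 - r) := fun r hr =>
    mul_pos hr.1 (sub_pos.2 hr.2)
  have hle : ∀ r : ℝ, √(r * (1 - r)) ≤ 1 / 2 := fun r => by
    rw [Real.sqrt_le_iff]
    exact ⟨by norm_num, by nlinarith [sq_nonneg (r - 1 / 2)]⟩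
  have hd : ∀ r : ℝ, HasDerivAt (fun r => r * (1 - r)) (1 - 2 * r) r := fun r => by
    refine ((hasDerivAt_id r).mul ((hasDerivAt_id r).const_sub 1)).congr_deriv ?_
    simp only [id]
    ring
  have hF : ∀ r ∈ Set.Ioo (0 : ℝ) 1, HasDerivAt (fun r => √(r * (1 - r)))
      ((1 - 2 * r) / (2 * √(r * (1 - r)))) r := fun r hr =>
    (hd r).sqrt (hpos r hr).ne'
  have hl : ∀ r ∈ Set.Ioo (0 : ℝ) 1, HasDerivAt (fun r => Real.log (1 - r) - Real.log r)
      (-1 / (r * (1 - r))) r := fun r hr => by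
    have h0 := hr.1.ne'
    have h1 : 1 - r ≠ 0 := (sub_pos.2 hr.2).ne'
    refine ((((hasDerivAt_id r).const_sub 1).log h1).sub
      ((hasDerivAt_id r).log h0)).congr_deriv ?_
    simp only [id]
    field_simp
    ring
  refine concaveOn_of_hasDerivWithinAt2_nonpos (convex_Icc 0 1)
    (f' := fun r => (1 - 2 * r) / (2 * √(r * (1 - r))) / √(w * (1 - w))
      - (Real.log (1 - r) - Real.log r))
    (f'' := fun r => -1 / (4 * √(r * (1 - r)) ^ 3) / √(w * (1 - w)) - -1 / (r * (1 - r)))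
    (by fun_prop) ?_ ?_ ?_
  · intro r hr
    rw [interior_Icc] at hr
    exact (((hF r hr).div_const _).sub
      (Real.hasDerivAt_binEntropy hr.1.ne' hr.2.ne)).hasDerivWithinAt
  · intro r hr
    rw [interior_Icc] at hr
    have hs := Real.sqrt_pos.2 (hpos r hr)
    have h2 : HasDerivAt (fun r => (1 - 2 * r) / (2 * √(r * (1 - r))))
        (-1 / (4 * √(r * (1 - r)) ^ 3)) r := by
      refine ((((hasDerivAt_id r).const_mul 2).const_sub 1).div ((hF r hr).const_mul 2)
        (by positivity)).congr_deriv ?_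
      have hsq := Real.sq_sqrt (hpos r hr).le
      simp only [id]
      field_simp
      rw [hsq]
      ring
    exact ((h2.div_const _).sub (hl r hr)).hasDerivWithinAt
  · intro r hr
    rw [interior_Icc] at hr
    have hs := Real.sqrt_pos.2 (hpos r hr)
    have hsw := Real.sqrt_pos.2 (hpos w hw)
    have hsq := Real.sq_sqrt (hpos r hr).le
    have key : 1 / (r * (1 - r)) ≤ 1 / (4 * √(r * (1 - r)) ^ 3 * √(w * (1 - w))) := by
      apply one_div_le_one_div_of_le (by positivity)
      calc 4 * √(r * (1 - r)) ^ 3 * √(w * (1 - w))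
          = √(r * (1 - r)) ^ 2 * (4 * (√(r * (1 - r)) * √(w * (1 - w)))) := by ring
        _ ≤ √(r * (1 - r)) ^ 2 * 1 := by
            gcongr
            nlinarith [hle r, hle w, mul_le_mul (hle r) (hle w) hsw.le (by norm_num)]
        _ = r * (1 - r) := by rw [hsq, mul_one]
    have e1 : -1 / (4 * √(r * (1 - r)) ^ 3) / √(w * (1 - w))
        = -(1 / (4 * √(r * (1 - r)) ^ 3 * √(w * (1 - w)))) := by
      rw [div_div]; ring
    have e2 : -1 / (r * (1 - r)) = -(1 / (r * (1 - r))) := by ring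
    rw [e1, e2]
    linarith

/-- By Bayes' rule w*p/z is the posterior of the first label after an outcome of likelihoods p and
q, and its complement is (1-w)*q/z. Summed over the two outcomes, the right-hand side becomes the
Bhattacharyya coefficient. -/
theorem mul_sqrt_posterior {w p q z : ℝ} (hw : w ∈ Set.Ioo (0 : ℝ) 1) (hp : 0 < p) (hq : 0 < q)
    (hz : w * p + (1 - w) * q = z) :
    z * (√(w * p / z * (1 - w * p / z)) / √(w * (1 - w))) = √(p * q) := by
  have h1 : 0 < 1 - w := sub_pos.2 hw.2
  have hz0 : 0 < z := by rw [← hz]; have := hw.1; positivity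
  have hw' : 0 < w * (1 - w) := mul_pos hw.1 h1
  have e : w * p / z * (1 - w * p / z) = (w * (1 - w)) * (p * q) / z ^ 2 := by
    field_simp
    rw [← hz]
    ring
  rw [e, Real.sqrt_div (by positivity), Real.sqrt_sq hz0.le, Real.sqrt_mul hw'.le]
  have := Real.sqrt_pos.2 hw'
  field_simp

/-- Contribution of one outcome to the conditional entropy of the label. Summed over both outcomes,
it is the prior entropy minus the Jensen-Shannon divergence. -/
theorem mul_binEntropy_posterior {w p q z : ℝ} (hw : w ∈ Set.Ioo (0 : ℝ) 1) (hp : 0 < p)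
    (hq : 0 < q) (hz : w * p + (1 - w) * q = z) :
    z * Real.binEntropy (w * p / z)
      = -(w * (p * Real.log (p / z))) - (1 - w) * (q * Real.log (q / z))
        - w * p * Real.log w - (1 - w) * q * Real.log (1 - w) := by
  have h1 : 0 < 1 - w := sub_pos.2 hw.2
  have h0 := hw.1
  have hz0 : 0 < z := by rw [← hz]; positivity
  have e : 1 - w * p / z = (1 - w) * q / z := by
    field_simp
    rw [← hz]
    ring
  have hwp : z * (w * p / z) = w * p := by field_simp
  have hwq : z * ((1 - w) * q / z) = (1 - w) * q := by field_simp
  rw [Real.binEntropy, e, Real.log_inv, Real.log_inv, mul_add, ← mul_assoc, ← mul_assoc, hwp, hwq,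
    Real.log_div (by positivity) hz0.ne', Real.log_div (by positivity) hz0.ne',
    Real.log_mul h0.ne' hp.ne', Real.log_mul h1.ne' hq.ne', Real.log_div hp.ne' hz0.ne',
    Real.log_div hq.ne' hz0.ne']
  ring

/-- The Jensen-Shannon divergence, with any weights, is at most the squared Hellinger distance. -/
theorem jensenShannon_le {w p q z : ℝ} (hw : w ∈ Set.Ioo (0 : ℝ) 1) (hp : p ∈ Set.Ioo (0 : ℝ) 1)
    (hq : q ∈ Set.Ioo (0 : ℝ) 1) (hz : w * p + (1 - w) * q = z) :
    w * bernoulliKL p z + (1 - w) * bernoulliKL q z ≤ 1 - bhattacharyya p q := by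
  have h1 : 0 < 1 - w := sub_pos.2 hw.2
  have h0 := hw.1
  have hp0 := hp.1
  have hq0 := hq.1
  have hp1 : 0 < 1 - p := sub_pos.2 hp.2
  have hq1 : 0 < 1 - q := sub_pos.2 hq.2
  have hz0 : 0 < z := by rw [← hz]; positivity
  have hz' : w * (1 - p) + (1 - w) * (1 - q) = 1 - z := by rw [← hz]; ring
  have hz1 : 0 < 1 - z := by rw [← hz']; positivity
  have hmem : w * p / z ∈ Set.Icc (0 : ℝ) 1 :=
    ⟨by positivity, (div_le_one hz0).2 (by rw [← hz]; nlinarith)⟩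
  have hmem' : w * (1 - p) / (1 - z) ∈ Set.Icc (0 : ℝ) 1 :=
    ⟨by positivity, (div_le_one hz1).2 (by rw [← hz']; nlinarith)⟩
  -- Jensen's inequality at the two posteriors, with the outcome probabilities z and 1 - z as
  -- weights; their average is the prior w, where the root term equals 1.
  have hJ := (concaveOn_sqrt_div_sub_binEntropy hw).2 hmem hmem' hz0.le hz1.le (by ring)
  have e : z * (w * p / z) + (1 - z) * (w * (1 - p) / (1 - z)) = w := by
    field_simp
    ring
  simp only [smul_eq_mul] at hJ
  rw [e, div_self (Real.sqrt_pos.2 (mul_pos h0 h1)).ne', mul_sub z, mul_sub (1 - z),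
    mul_sqrt_posterior hw hp0 hq0 hz, mul_sqrt_posterior hw hp1 hq1 hz',
    mul_binEntropy_posterior hw hp0 hq0 hz, mul_binEntropy_posterior hw hp1 hq1 hz',
    Real.binEntropy, Real.log_inv, Real.log_inv] at hJ
  unfold bernoulliKL bhattacharyya
  linarith

theorem continuousOn_bernoulliKL (p : ℝ) : ContinuousOn (bernoulliKL p) (Set.Ioo 0 1) := by
  intro x hx
  have h0 := hx.1.ne'
  have h1 : 1 - x ≠ 0 := (sub_pos.2 hx.2).ne'
  by_cases hp : p = 0
  · subst hp
    unfold bernoulliKL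
    have : (1 - 0) / (1 - x) ≠ 0 := by simpa using h1
    refine ContinuousAt.continuousWithinAt ?_
    simp only [zero_mul, zero_add]
    fun_prop (disch := assumption)
  by_cases hp1 : 1 - p = 0
  · unfold bernoulliKL
    have : p / x ≠ 0 := div_ne_zero hp h0
    refine ContinuousAt.continuousWithinAt ?_
    simp only [hp1, zero_mul, add_zero]
    fun_prop (disch := assumption)
  have h2 : p / x ≠ 0 := div_ne_zero hp h0
  have h3 : (1 - p) / (1 - x) ≠ 0 := div_ne_zero hp1 h1
  unfold bernoulliKL
  refine ContinuousAt.continuousWithinAt ?_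
  fun_prop (disch := assumption)

theorem bernoulliKL_self {p : ℝ} (hp : p ∈ Set.Ioo (0 : ℝ) 1) : bernoulliKL p p = 0 := by
  unfold bernoulliKL
  rw [div_self hp.1.ne', div_self (sub_pos.2 hp.2).ne']
  simp

theorem bernoulliKL_nonneg {p x : ℝ} (hp : p ∈ Set.Ioo (0 : ℝ) 1) (hx : x ∈ Set.Ioo (0 : ℝ) 1) :
    0 ≤ bernoulliKL p x := by
  have hp1 : 0 < 1 - p := sub_pos.2 hp.2
  have hx1 : 0 < 1 - x := sub_pos.2 hx.2
  have h1 := Real.one_sub_inv_le_log_of_pos (div_pos hp.1 hx.1)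
  have h2 := Real.one_sub_inv_le_log_of_pos (div_pos hp1 hx1)
  have e1 : p * (1 - (p / x)⁻¹) = p - x := by have := hp.1; field_simp
  have e2 : (1 - p) * (1 - ((1 - p) / (1 - x))⁻¹) = x - p := by field_simp; ring
  unfold bernoulliKL
  linarith [mul_le_mul_of_nonneg_left h1 hp.1.le, mul_le_mul_of_nonneg_left h2 hp1.le]

/-- Between two Bernoulli distributions there is one whose divergence from both is smaller than
their Bhattacharyya distance. -/
theorem exists_bernoulliKL_lt {p q : ℝ} (hp : p ∈ Set.Ioo (0 : ℝ) 1) (hq : q ∈ Set.Ioo (0 : ℝ) 1)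
    (hqp : q < p) : ∃ z ∈ Set.Ioo (0 : ℝ) 1,
      bernoulliKL p z < -Real.log (bhattacharyya p q) ∧
      bernoulliKL q z < -Real.log (bhattacharyya p q) := by
  have hsub : Set.Icc q p ⊆ Set.Ioo 0 1 := fun x hx =>
    ⟨hq.1.trans_le hx.1, hx.2.trans_lt hp.2⟩
  have hcont : ContinuousOn (fun x => bernoulliKL p x - bernoulliKL q x) (Set.Icc q p) :=
    ((continuousOn_bernoulliKL p).sub (continuousOn_bernoulliKL q)).mono hsub
  -- The difference of the divergences is nonnegative at q and nonpositive at p.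
  obtain ⟨z, hz, hz0⟩ := intermediate_value_Icc' hqp.le hcont (show (0 : ℝ) ∈ _ from
    ⟨by simp [bernoulliKL_self hp, bernoulliKL_nonneg hq hp],
      by simp [bernoulliKL_self hq, bernoulliKL_nonneg hp hq]⟩)
  have heq : bernoulliKL p z = bernoulliKL q z := sub_eq_zero.1 hz0
  have hB0 := bhattacharyya_pos hp hq
  have hB1 := bhattacharyya_lt_one hp hq hqp.ne'
  have hlog := Real.log_lt_sub_one_of_pos hB0 hB1.ne
  refine ⟨z, hsub hz, ?_⟩
  rw [← heq, and_self]
  -- At an endpoint the common divergence is 0; elsewhere the mixture weight lies strictly between 0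
  -- and 1.
  rcases eq_or_lt_of_le hz.1 with rfl | h1
  · rw [heq, bernoulliKL_self hq]
    linarith
  rcases eq_or_lt_of_le hz.2 with rfl | h2
  · rw [bernoulliKL_self hp]
    linarith
  have hd : 0 < p - q := sub_pos.2 hqp
  have hw : (z - q) / (p - q) ∈ Set.Ioo (0 : ℝ) 1 :=
    ⟨div_pos (sub_pos.2 h1) hd, (div_lt_one hd).2 (by linarith)⟩
  have hJ := jensenShannon_le hw hp hq (z := z) (by field_simp; ring)
  rw [← heq] at hJ
  linarith

/-- The alternative model must have a unique best arm, so a common mean z is not enough. Continuity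
of the divergence allows y to be moved slightly to the right of x = z within the strict slack. -/
theorem exists_separated_bernoulliKL_lt {p q : ℝ} (hp : p ∈ Set.Ioo (0 : ℝ) 1)
    (hq : q ∈ Set.Ioo (0 : ℝ) 1) (hqp : q < p) :
    ∃ c, 0 < c ∧ c < -Real.log (bhattacharyya p q) ∧
      ∃ x ∈ Set.Ioo (0 : ℝ) 1, ∃ y ∈ Set.Ioo (0 : ℝ) 1, x < y ∧
        bernoulliKL p x ≤ c ∧ bernoulliKL q y ≤ c := by
  obtain ⟨z, hz, h1, h2⟩ := exists_bernoulliKL_lt hp hq hqp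
  obtain ⟨c, hc1, hc2⟩ := exists_between (max_lt h1 h2)
  have hcp := (le_max_left _ _).trans_lt hc1
  have hcq := (le_max_right _ _).trans_lt hc1
  have hnhds : Set.Ioo (0 : ℝ) 1 ∈ 𝓝 z := isOpen_Ioo.mem_nhds hz
  have hev : ∀ᶠ x in 𝓝 z, bernoulliKL q x < c ∧ x ∈ Set.Ioo (0 : ℝ) 1 :=
    (((continuousOn_bernoulliKL q).continuousAt hnhds).eventually_lt_const hcq).and hnhds
  obtain ⟨y, ⟨hy, hy01⟩, hzy⟩ :=
    ((hev.filter_mono nhdsWithin_le_nhds).and (self_mem_nhdsWithin (s := Set.Ioi z))).exists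
  exact ⟨c, (bernoulliKL_nonneg hp hz).trans_lt hcp, hc2, z, hz, y, hy01, hzy, hcp.le, hy.le⟩

/-! ### The law of the draws and Bernoulli integrals -/

instance (ν : Model) : IsProbabilityMeasure ν.law := by
  unfold Model.law
  infer_instance

theorem map_draw_law (ν : Model) (t : ℕ) (a : Fin 2) :
    ν.law.map (fun ω : Draws => ω t a) = ν a := by
  have h1 := measurePreserving_eval_infinitePi
    (fun _ : ℕ => Measure.pi (fun a : Fin 2 => (ν a : Measure ℝ))) t
  have h2 := measurePreserving_eval (fun a : Fin 2 => (ν a : Measure ℝ)) a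
  exact (h2.comp h1).map_eq

theorem iIndepFun_law (ν : Model) {β : ℕ → Type*} [∀ t, MeasurableSpace (β t)]
    {X : ∀ t, (Fin 2 → ℝ) → β t} (hX : ∀ t, Measurable (X t)) :
    iIndepFun (fun t (ω : Draws) => X t (ω t)) ν.law :=
  iIndepFun_infinitePi hX

theorem lintegral_bernoulli (p : unitInterval) (f : ℝ → ℝ≥0∞) :
    ∫⁻ x, f x ∂(bernoulli p : Measure ℝ)
      = ENNReal.ofReal p * f 1 + ENNReal.ofReal (1 - p) * f 0 := by
  change ∫⁻ x, f x ∂(bernoulliMeasure (1 : ℝ) 0 p) = _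
  rw [bernoulliMeasure_def, lintegral_add_measure]
  simp only [lintegral_smul_measure, lintegral_dirac]
  have h1 : ENNReal.ofReal (p : ℝ) = (unitInterval.toNNReal p : ℝ≥0∞) := by
    rw [← ENNReal.ofReal_coe_nnreal]; rfl
  have h2 : ENNReal.ofReal (1 - p : ℝ) = (unitInterval.toNNReal (unitInterval.symm p) : ℝ≥0∞) := by
    rw [← ENNReal.ofReal_coe_nnreal]; rfl
  rw [h1, h2]
  rfl

theorem integral_bernoulli (p : unitInterval) (f : ℝ → ℝ) :
    ∫ x, f x ∂(bernoulli p : Measure ℝ) = p * f 1 + (1 - p) * f 0 := by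
  change ∫ x, f x ∂(bernoulliMeasure (1 : ℝ) 0 p) = _
  rw [integral_bernoulliMeasure]
  simp

theorem integrable_bernoulli (p : unitInterval) (f : ℝ → ℝ) :
    Integrable f (bernoulli p : Measure ℝ) := by
  change Integrable f (bernoulliMeasure (1 : ℝ) 0 p)
  rw [bernoulliMeasure_def]
  exact ((integrable_dirac (by simp)).smul_measure_nnreal).add_measure
    ((integrable_dirac (by simp)).smul_measure_nnreal)

theorem mean_bernoulli (p : Fin 2 → unitInterval) (a : Fin 2) :
    Model.mean (fun i => bernoulli (p i)) a = p a := by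
  simp [Model.mean, integral_bernoulli]

theorem isBestArm_bernoulli_iff {p : Fin 2 → unitInterval} {a b : Fin 2} (h : p b < p a)
    (c : Fin 2) : Model.IsBestArm (fun i => bernoulli (p i)) c ↔ c = a := by
  have h' : (p b : ℝ) < p a := h
  have hab : a ≠ b := by rintro rfl; exact lt_irrefl _ h
  simp only [Model.IsBestArm, mean_bernoulli]
  constructor
  · intro hc
    by_contra hne
    have : c = b := by omega
    subst this
    exact absurd (hc a) (not_le.2 h')
  · rintro rfl d
    by_cases hd : d = c
    · rw [hd]
    · have : d = b := by omega
      rw [this]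
      exact h'.le

theorem mem_bernoulliModels_iff (ν : Model) : ν ∈ bernoulliModels ↔
    ∃ p : Fin 2 → unitInterval, (∀ i, (p i : ℝ) ∈ Set.Ioo 0 1) ∧
      (∃ a b, p b < p a) ∧ ν = fun i => bernoulli (p i) := by
  constructor
  · rintro ⟨p, q, hp, hq, hpq, rfl⟩
    refine ⟨![p, q], ?_, ?_, ?_⟩
    · intro i
      fin_cases i
      exacts [hp, hq]
    · rcases lt_or_gt_of_ne hpq with h | h
      exacts [⟨1, 0, h⟩, ⟨0, 1, h⟩]
    · funext i
      fin_cases i <;> rfl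
  · rintro ⟨p, hp, ⟨a, b, hab⟩, rfl⟩
    refine ⟨p 0, p 1, hp 0, hp 1, ?_, ?_⟩
    · intro h
      have : ∀ i, p i = p 0 := fun i => by
        fin_cases i
        exacts [rfl, h.symm]
      rw [this a, this b] at hab
      exact lt_irrefl _ hab
    · funext i
      fin_cases i <;> rfl

/-! ### Uniform sampling -/

/-- The arms are drawn alternately. -/
def alternatingArm (t : ℕ) : Fin 2 := if t % 2 = 0 then 0 else 1

/-- The sampling rule that draws the arms alternately. -/
def alternatingRule : SamplingRule where
  arm t _ := alternatingArm t
  predictable _ := measurable_const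

/-- The lead of the arm other than `a` over the arm `a` in cumulated rewards after `n` rounds of
alternating draws. -/
noncomputable def lead (a : Fin 2) (n : ℕ) (ω : Draws) : ℝ :=
  ∑ s ∈ Finset.range n, (if alternatingArm s = a then -1 else 1) * ω s (alternatingArm s)

theorem lead_one (n : ℕ) (ω : Draws) : lead 1 n ω = -lead 0 n ω := by
  simp only [lead, ← Finset.sum_neg_distrib, ← neg_mul]
  refine Finset.sum_congr rfl fun s _ => ?_
  congr 1
  unfold alternatingArm
  split_ifs <;> simp_all

theorem measurable_observation_filtration (S : SamplingRule) {s t : ℕ} (h : s < t) :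
    Measurable[S.filtration t] (observation S.arm s) := by
  have : Measurable[S.filtration t] (fun ω => (S.arm s ω, observation S.arm s ω)) :=
    Measurable.mono (comap_measurable _) (le_iSup (fun j : Fin t => MeasurableSpace.comap
      (fun ω => (S.arm j ω, observation S.arm j ω)) inferInstance) ⟨s, h⟩) le_rfl
  exact measurable_snd.comp this

theorem measurable_lead (a : Fin 2) {n t : ℕ} (h : n ≤ t) :
    Measurable[alternatingRule.filtration t] (lead a n) := by
  refine @Finset.measurable_fun_sum _ _ _ _ _ _ (alternatingRule.filtration t) _ _ fun s hs => ?_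
  exact Measurable.const_mul (measurable_observation_filtration alternatingRule
    ((Finset.mem_range.1 hs).trans_le h)) _

/-- Draw the arms alternately, and recommend the arm with the largest cumulated reward after
the first `2 * (t / 2)` draws. -/
noncomputable def alternatingStrategy (M : Set Model) (t : ℕ) : Strategy M where
  toSamplingRule := alternatingRule
  tau _ := t
  isStoppingTime := isStoppingTime_const _ t
  tau_finite _ _ := ae_of_all _ fun _ => ENat.natCast_lt_top t
  -- Stopping the count at an even number of rounds gives both arms equally many draws.
  recommend ω := if lead 0 (2 * (t / 2)) ω ≤ 0 then 0 else 1
  measurable_recommend := by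
    rw [IsStoppingTime.measurableSpace_const]
    exact Measurable.ite (measurableSet_le (measurable_lead 0 (Nat.mul_div_le t 2))
      measurable_const) measurable_const measurable_const

theorem mgf_draw_bernoulli (p : Fin 2 → unitInterval) (t : ℕ) (a : Fin 2) (c l : ℝ) :
    mgf (fun ω : Draws => c * ω t a) (Model.law fun i => bernoulli (p i)) l
      = p a * Real.exp (l * c) + (1 - p a) := by
  have h : ∫ x, Real.exp (l * (c * x)) ∂((Model.law fun i => bernoulli (p i)).map
      (fun ω : Draws => ω t a)) = ∫ ω, Real.exp (l * (c * ω t a))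
        ∂(Model.law fun i => bernoulli (p i)) :=
    integral_map (Measurable.aemeasurable (by fun_prop)) (by fun_prop)
  rw [map_draw_law, integral_bernoulli] at h
  rw [mgf, ← h]
  simp

theorem mgf_lead_bernoulli (p : Fin 2 → unitInterval) {a b : Fin 2} (hab : a ≠ b) (l : ℝ) (m : ℕ) :
    mgf (lead a (2 * m)) (Model.law fun i => bernoulli (p i)) l
      = ((p a * Real.exp (-l) + (1 - p a)) * (p b * Real.exp l + (1 - p b))) ^ m := by
  have hind := iIndepFun_law (fun i => bernoulli (p i)) (X := fun s (x : Fin 2 → ℝ) =>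
    (if alternatingArm s = a then (-1 : ℝ) else 1) * x (alternatingArm s)) (by fun_prop)
  have hsum := hind.mgf_sum (t := l) (by fun_prop) (Finset.range (2 * m))
  have he : lead a (2 * m) = ∑ s ∈ Finset.range (2 * m), fun ω : Draws =>
      (if alternatingArm s = a then (-1 : ℝ) else 1) * ω s (alternatingArm s) := by
    ext ω
    simp [lead]
  rw [he, hsum]
  simp only [mgf_draw_bernoulli]
  clear hsum he hind
  induction m with
  | zero => simp
  | succ m ih =>
    rw [mul_add, Finset.prod_range_succ, Finset.prod_range_succ, ih, pow_succ, mul_assoc]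
    congr 1
    have h0 : alternatingArm (2 * m) = 0 := if_pos (by omega)
    have h1 : alternatingArm (2 * m + 1) = 1 := if_neg (by omega)
    simp only [h0, h1]
    obtain ⟨rfl, rfl⟩ | ⟨rfl, rfl⟩ : (a = 0 ∧ b = 1) ∨ (a = 1 ∧ b = 0) := by omega
    · simp
    · simp [mul_comm]

/-- The optimal exponent is e^l = √(x(1-y)/((1-x)y)), which is at least 1 since y < x. It makes the
cross terms x(1-y)e^(-l) and y(1-x)e^l both equal to √(xy)√((1-x)(1-y)), so that the product is a
perfect square. -/
theorem chernoff_factor {x y : ℝ} (hx : x ∈ Set.Ioo (0 : ℝ) 1) (hy : y ∈ Set.Ioo (0 : ℝ) 1)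
    (hyx : y < x) : ∃ l, 0 ≤ l ∧
      (x * Real.exp (-l) + (1 - x)) * (y * Real.exp l + (1 - y)) = bhattacharyya x y ^ 2 := by
  have hx0 := hx.1
  have hy0 := hy.1
  have hx1 : 0 < 1 - x := sub_pos.2 hx.2
  have hy1 : 0 < 1 - y := sub_pos.2 hy.2
  unfold bhattacharyya
  have hu2 := Real.sq_sqrt (mul_pos hx0 hy0).le
  have hv2 := Real.sq_sqrt (mul_pos hx1 hy1).le
  have hu := Real.sqrt_pos.2 (mul_pos hx0 hy0)
  have hv := Real.sqrt_pos.2 (mul_pos hx1 hy1)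
  set u := √(x * y)
  set v := √((1 - x) * (1 - y))
  have hr : 1 ≤ x * v / ((1 - x) * u) := by
    rw [one_le_div (by positivity)]
    refine le_of_sq_le_sq ?_ (by positivity)
    rw [mul_pow, mul_pow, hu2, hv2]
    have : 0 < x * (1 - x) * (x - y) := mul_pos (mul_pos hx0 hx1) (sub_pos.2 hyx)
    nlinarith
  refine ⟨Real.log (x * v / ((1 - x) * u)), Real.log_nonneg hr, ?_⟩
  rw [Real.exp_neg, Real.exp_log (by positivity)]
  have e1 : x * (x * v / ((1 - x) * u))⁻¹ = (1 - x) * u / v := by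
    field_simp
  have e2 : y * (x * v / ((1 - x) * u)) = u * v / (1 - x) := by
    field_simp
    rw [hu2]
    ring
  rw [e1, e2]
  field_simp
  linear_combination -hv2

theorem law_lead_nonneg_le {p : Fin 2 → unitInterval} (hp : ∀ i, (p i : ℝ) ∈ Set.Ioo 0 1)
    {a b : Fin 2} (hba : p b < p a) (m : ℕ) :
    (Model.law fun i => bernoulli (p i)) {ω | 0 ≤ lead a (2 * m) ω}
      ≤ ENNReal.ofReal (bhattacharyya (p a) (p b) ^ (2 * m)) := by
  have hab : a ≠ b := by rintro rfl; exact lt_irrefl _ hba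
  obtain ⟨l, hl, he⟩ := chernoff_factor (hp a) (hp b) hba
  have hm := mgf_lead_bernoulli p hab l m
  rw [he, ← pow_mul] at hm
  have hpos : mgf (lead a (2 * m)) (Model.law fun i => bernoulli (p i)) l ≠ 0 := by
    rw [hm]
    exact pow_ne_zero _ (bhattacharyya_pos (hp a) (hp b)).ne'
  have h := measure_ge_le_exp_mul_mgf (X := lead a (2 * m))
    -- Integrability of the exponential comes for free: otherwise the moment generating function
    -- would take its default value 0.
    (μ := Model.law fun i => bernoulli (p i)) 0 hl (by
      by_contra hint
      exact hpos (mgf_undef hint))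
  rw [hm, mul_zero, Real.exp_zero, one_mul] at h
  rw [← ofReal_measureReal]
  exact ENNReal.ofReal_le_ofReal h

theorem errorProb_alternatingStrategy_le (M : Set Model) {p : Fin 2 → unitInterval}
    (hp : ∀ i, (p i : ℝ) ∈ Set.Ioo 0 1) {a b : Fin 2} (hba : p b < p a) (t : ℕ) :
    (alternatingStrategy M t).errorProb (fun i => bernoulli (p i))
      ≤ ENNReal.ofReal (bhattacharyya (p a) (p b) ^ t / bhattacharyya (p a) (p b)) := by
  have hB0 := bhattacharyya_pos (hp a) (hp b)
  have hB1 := (bhattacharyya_lt_one (hp a) (hp b)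
    (fun h => hba.ne' (Subtype.ext h))).le
  refine le_trans (measure_mono ?_) ((law_lead_nonneg_le hp hba (t / 2)).trans
    (ENNReal.ofReal_le_ofReal ?_))
  -- Whichever arm is best, an error forces `0 ≤ lead a`; ties are included in this event.
  · intro ω hω
    simp only [Set.mem_ofPred_eq, isBestArm_bernoulli_iff hba, alternatingStrategy] at hω ⊢
    obtain rfl | rfl : a = 0 ∨ a = 1 := by omega
    · by_contra hneg
      exact hω (if_pos (not_le.1 hneg).le)
    · rw [lead_one]
      by_contra hneg
      exact hω (if_neg (by linarith))
  -- One factor B is lost at most, since 2 * (t / 2) + 1 ≥ t.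
  · rw [le_div_iff₀ hB0, ← pow_succ]
    exact pow_le_pow_of_le_one hB0.le hB1 (by omega)

/-- Uniform sampling as a consistent procedure for Bernoulli models. -/
noncomputable def alternatingProcedure : ConsistentProcedure bernoulliModels where
  strategy := alternatingStrategy bernoulliModels
  tau_eq _ _ _ := ae_of_all _ fun _ => rfl
  consistent ν hν := by
    obtain ⟨p, hp, ⟨a, b, hba⟩, rfl⟩ := (mem_bernoulliModels_iff ν).1 hν
    refine tendsto_of_tendsto_of_tendsto_of_le_of_le tendsto_const_nhds ?_
      (fun _ => zero_le) (errorProb_alternatingStrategy_le _ hp hba)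
    have hB0 := bhattacharyya_pos (hp a) (hp b)
    have hB1 := bhattacharyya_lt_one (hp a) (hp b) (fun h => hba.ne' (Subtype.ext h))
    have h := (tendsto_pow_atTop_nhds_zero_of_lt_one hB0.le hB1).div_const
      (bhattacharyya (p a) (p b))
    simpa using ENNReal.tendsto_ofReal h

theorem le_rate_alternatingProcedure {p : Fin 2 → unitInterval}
    (hp : ∀ i, (p i : ℝ) ∈ Set.Ioo 0 1) {a b : Fin 2} (hba : p b < p a) :
    ((-Real.log (bhattacharyya (p a) (p b)) : ℝ) : EReal)
      ≤ alternatingProcedure.rate (fun i => bernoulli (p i)) := by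
  have hB0 := bhattacharyya_pos (hp a) (hp b)
  set β := bhattacharyya (p a) (p b) with hβ
  have hlim : Tendsto (fun t : ℕ => ((-Real.log β + Real.log β / t : ℝ) : EReal)) atTop
      (𝓝 ((-Real.log β : ℝ) : EReal)) := by
    refine (continuous_coe_real_ereal.tendsto _).comp ?_
    simpa using tendsto_const_nhds.add (tendsto_const_div_atTop_nhds_zero_nat (Real.log β))
  rw [← hlim.limsup_eq]
  refine limsup_le_limsup ?_
  filter_upwards [eventually_gt_atTop 0] with t ht
  have ht' : (0 : ℝ) < t := Nat.cast_pos.2 ht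
  have hle : ENNReal.log ((alternatingProcedure.strategy t).errorProb fun i => bernoulli (p i))
      ≤ ((Real.log (β ^ t / β) : ℝ) : EReal) := by
    rw [← ENNReal.log_ofReal_of_pos (by positivity)]
    exact ENNReal.log_monotone (errorProb_alternatingStrategy_le _ hp hba t)
  calc ((-Real.log β + Real.log β / t : ℝ) : EReal)
      = -((Real.log (β ^ t / β) : ℝ) : EReal) / (t : EReal) := by
        rw [← EReal.coe_neg, ← EReal.coe_natCast, ← EReal.coe_div]
        congr 1
        rw [Real.log_div (by positivity) hB0.ne', Real.log_pow]
        field_simp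
        ring
    _ ≤ _ := EReal.div_le_div_right_of_nonneg (by positivity) (EReal.neg_le_neg_iff.2 hle)

theorem fixedBudgetComplexity_bernoulli_le {p : Fin 2 → unitInterval}
    (hp : ∀ i, (p i : ℝ) ∈ Set.Ioo 0 1) {a b : Fin 2} (hba : p b < p a) :
    fixedBudgetComplexity bernoulliModels (fun i => bernoulli (p i))
      ≤ (ENNReal.ofReal (-Real.log (bhattacharyya (p a) (p b))))⁻¹ := by
  refine (iInf_le _ alternatingProcedure).trans (ENNReal.inv_le_inv.2 ?_)
  have h := EReal.toENNReal_le_toENNReal (le_rate_alternatingProcedure hp hba)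
  rwa [EReal.toENNReal_of_ne_top (EReal.coe_ne_top _), EReal.toReal_coe] at h

/-! ### Independence of the past and the next draw -/

theorem SamplingRule.measurable_arm_filtration (S : SamplingRule) (t : ℕ) :
    Measurable[S.filtration t] (S.arm t) :=
  S.predictable t

theorem SamplingRule.measurableSet_arm_eq (S : SamplingRule) (t : ℕ) (a : Fin 2) :
    MeasurableSet[S.filtration t] {ω | S.arm t ω = a} :=
  S.measurable_arm_filtration t (measurableSet_singleton a)

/-- Strong induction is needed because each chosen arm is itself a function of earlier observations.
This inclusion is what makes the past independent of the draws of round t. -/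
theorem SamplingRule.filtration_le_draws (S : SamplingRule) (t : ℕ) :
    S.filtration t ≤ ⨆ s ∈ Set.Iio t, MeasurableSpace.comap (fun ω : Draws => ω s)
      inferInstance := by
  induction t using Nat.strong_induction_on with
  | _ t ih =>
    refine iSup_le fun s => ?_
    have hs : (s : ℕ) < t := s.2
    have hA : Measurable[⨆ s ∈ Set.Iio t, MeasurableSpace.comap (fun ω : Draws => ω s)
        inferInstance] (S.arm s) := by
      refine (S.measurable_arm_filtration s).mono ((ih s hs).trans ?_) le_rfl
      exact biSup_mono fun r hr => lt_trans hr hs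
    have hD : Measurable[⨆ s ∈ Set.Iio t, MeasurableSpace.comap (fun ω : Draws => ω s)
        inferInstance] (fun ω : Draws => ω s) :=
      (comap_measurable _).mono (le_iSup₂ (f := fun (r : ℕ) (_ : r ∈ Set.Iio t) =>
        MeasurableSpace.comap (fun ω : Draws => ω r) inferInstance) (s : ℕ) hs) le_rfl
    have h2 : Measurable (fun q : (Fin 2 → ℝ) × Fin 2 => q.1 q.2) :=
      measurable_from_prod_countable_left fun a => measurable_pi_apply a
    have hO : Measurable[⨆ s ∈ Set.Iio t, MeasurableSpace.comap (fun ω : Draws => ω s)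
        inferInstance] (observation S.arm s) :=
      h2.comp (hD.prodMk hA)
    exact (hA.prodMk hO).comap_le

theorem SamplingRule.indep_filtration_draw (S : SamplingRule) (ν : Model) (t : ℕ) :
    Indep (S.filtration t) (MeasurableSpace.comap (fun ω : Draws => ω t) inferInstance)
      ν.law := by
  have h := indep_iSup_of_disjoint (fun s => (measurable_pi_apply s).comap_le)
    (iIndepFun_law ν (X := fun _ x => x) fun _ => measurable_id).iIndep
    (S := Set.Iio t) (T := {t}) (by simp)
  rw [iSup_singleton] at h
  exact indep_of_indep_of_le_left h (S.filtration_le_draws t)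

/-- Conditionally on the past, the next observation is distributed according to the arm chosen. -/
theorem SamplingRule.lintegral_mul_observation (S : SamplingRule) (ν : Model) (t : ℕ)
    {f : Draws → ℝ≥0∞} (hf : Measurable[S.filtration t] f) {g : Fin 2 → ℝ → ℝ≥0∞}
    (hg : ∀ a, Measurable (g a)) :
    ∫⁻ ω, f ω * g (S.arm t ω) (observation S.arm t ω) ∂ν.law
      = ∑ a, (∫⁻ ω in {ω | S.arm t ω = a}, f ω ∂ν.law) * ∫⁻ x, g a x ∂(ν a : Measure ℝ) := by
  have hle := S.filtration.le t
  have hm : ∀ a, MeasurableSet {ω | S.arm t ω = a} := fun a =>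
    hle _ (S.measurableSet_arm_eq t a)
  -- Splitting by the chosen arm replaces the observation by a fixed coordinate of round t, which is
  -- independent of the past.
  have hpt : ∀ ω, f ω * g (S.arm t ω) (observation S.arm t ω)
      = ∑ a, {ω | S.arm t ω = a}.indicator f ω * g a (ω t a) := fun ω => by
    rw [Finset.sum_eq_single (S.arm t ω)]
    · simp [observation]
    · intro b _ hb
      simp [Ne.symm hb]
    · simp
  have hfa : ∀ a, Measurable[S.filtration t] ({ω | S.arm t ω = a}.indicator f) := fun a =>
    hf.indicator (S.measurableSet_arm_eq t a)
  have hga : ∀ a, Measurable[MeasurableSpace.comap (fun ω : Draws => ω t) inferInstance]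
      (fun ω : Draws => g a (ω t a)) := fun a =>
    have h : Measurable fun x : Fin 2 → ℝ => g a (x a) := (hg a).comp (measurable_pi_apply a)
    h.comp (comap_measurable _)
  simp_rw [hpt]
  rw [lintegral_finsetSum]
  · refine Finset.sum_congr rfl fun a _ => ?_
    rw [lintegral_mul_eq_lintegral_mul_lintegral_of_independent_measurableSpace hle
      (measurable_pi_apply t).comap_le (S.indep_filtration_draw ν t) (hfa a) (hga a),
      lintegral_indicator (hm a), ← map_draw_law ν t a, lintegral_map (hg a) (by fun_prop)]
  · intro a _
    exact ((hfa a).mono hle le_rfl).mul ((hga a).mono (measurable_pi_apply t).comap_le le_rfl)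

/-! ### Change of measure -/

/-- The sum of the rewards `l a x` over the first `t` rounds, where `a` is the arm chosen and `x`
the observation made. -/
noncomputable def SamplingRule.cumulated (S : SamplingRule) (l : Fin 2 → ℝ → ℝ) (t : ℕ)
    (ω : Draws) : ℝ :=
  ∑ s ∈ Finset.range t, l (S.arm s ω) (observation S.arm s ω)

theorem measurable_uncurry_arm {E : Type*} [MeasurableSpace E] {g : Fin 2 → ℝ → E}
    (hg : ∀ a, Measurable (g a)) : Measurable (fun x : Fin 2 × ℝ => g x.1 x.2) :=
  measurable_from_prod_countable_right hg

theorem SamplingRule.measurable_step (S : SamplingRule) {E : Type*} [MeasurableSpace E]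
    {g : Fin 2 → ℝ → E} (hg : ∀ a, Measurable (g a)) {s t : ℕ} (h : s < t) :
    Measurable[S.filtration t] (fun ω => g (S.arm s ω) (observation S.arm s ω)) := by
  have h1 : Measurable[S.filtration t] (S.arm s) :=
    (S.measurable_arm_filtration s).mono (S.filtration.mono h.le) le_rfl
  exact (measurable_uncurry_arm hg).comp (h1.prodMk (measurable_observation_filtration S h))

theorem SamplingRule.measurable_cumulated (S : SamplingRule) {l : Fin 2 → ℝ → ℝ}
    (hl : ∀ a, Measurable (l a)) (t : ℕ) : Measurable[S.filtration t] (S.cumulated l t) :=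
  @Finset.measurable_fun_sum _ _ _ _ _ _ (S.filtration t) _ _ fun _ hs =>
    S.measurable_step hl (Finset.mem_range.1 hs)

/-- The generating sets form a π-system, so an identity of measures on the next sigma-algebra need
only be checked on a past event intersected with an event of the current round. -/
theorem SamplingRule.filtration_succ (S : SamplingRule) (t : ℕ) :
    S.filtration (t + 1) = MeasurableSpace.generateFrom
      {s | ∃ B, MeasurableSet[S.filtration t] B ∧ ∃ V : Set (Fin 2 × ℝ), MeasurableSet V ∧
        s = B ∩ (fun ω => (S.arm t ω, observation S.arm t ω)) ⁻¹' V} := by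
  apply le_antisymm
  · refine iSup_le fun s => ?_
    rintro _ ⟨V, hV, rfl⟩
    apply MeasurableSpace.measurableSet_generateFrom
    rcases Nat.lt_succ_iff_lt_or_eq.1 s.2 with h | h
    · refine ⟨_, ?_, Set.univ, MeasurableSet.univ, (Set.inter_univ _).symm⟩
      exact le_iSup (fun j : Fin t => MeasurableSpace.comap
        (fun ω => (S.arm j ω, observation S.arm j ω)) inferInstance) ⟨s, h⟩ _ ⟨V, hV, rfl⟩
    · refine ⟨Set.univ, MeasurableSet.univ, V, hV, ?_⟩
      rw [Set.univ_inter, h]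
  · refine MeasurableSpace.generateFrom_le ?_
    rintro _ ⟨B, hB, V, hV, rfl⟩
    refine MeasurableSet.inter (S.filtration.mono t.le_succ _ hB) ?_
    have h1 : Measurable[S.filtration (t + 1)] (S.arm t) :=
      (S.measurable_arm_filtration t).mono (S.filtration.mono t.le_succ) le_rfl
    exact (h1.prodMk (measurable_observation_filtration S t.lt_succ_self)) hV

theorem isPiSystem_inter_preimage {Ω E : Type*} (m : MeasurableSpace Ω) [MeasurableSpace E]
    (X : Ω → E) :
    IsPiSystem {s | ∃ B, MeasurableSet[m] B ∧ ∃ V : Set E, MeasurableSet V ∧ s = B ∩ X ⁻¹' V} := by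
  rintro _ ⟨B, hB, V, hV, rfl⟩ _ ⟨B', hB', V', hV', rfl⟩ -
  refine ⟨B ∩ B', hB.inter hB', V ∩ V', hV.inter hV', ?_⟩
  rw [Set.preimage_inter]
  exact Set.inter_inter_inter_comm _ _ _ _

/-- The likelihood ratio of two bandit models given the first `t` observations. -/
theorem SamplingRule.setLIntegral_exp_neg_cumulated (S : SamplingRule) {ν ν' : Model}
    {l : Fin 2 → ℝ → ℝ} (hl : ∀ a, Measurable (l a))
    (hd : ∀ a, (ν' a : Measure ℝ)
      = (ν a : Measure ℝ).withDensity fun x => ENNReal.ofReal (Real.exp (-l a x)))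
    (t : ℕ) {B : Set Draws} (hB : MeasurableSet[S.filtration t] B) :
    ∫⁻ ω in B, ENNReal.ofReal (Real.exp (-S.cumulated l t ω)) ∂ν.law = ν'.law B := by
  induction t generalizing B with
  | zero =>
    have hB' : MeasurableSet[⊥] B := by
      have : S.filtration 0 = ⊥ := iSup_of_empty _
      rwa [← this]
    rcases MeasurableSpace.measurableSet_bot_iff.1 hB' with rfl | rfl
    · simp
    · simp [SamplingRule.cumulated]
  | succ t ih =>
    set D : ℕ → Draws → ℝ≥0∞ := fun t ω => ENNReal.ofReal (Real.exp (-S.cumulated l t ω))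
      with hD
    have hDm : ∀ t, Measurable[S.filtration t] (D t) := fun t =>
      ((S.measurable_cumulated hl t).neg.exp).ennreal_ofReal
    have hle := S.filtration.le
    -- On the generators, the new likelihood factor turns the law `ν a` of the observation into `ν'
    -- a`, and the induction hypothesis does the same for the past event on which arm a is chosen.
    have hstep : ∀ B, MeasurableSet[S.filtration t] B → ∀ V : Set (Fin 2 × ℝ), MeasurableSet V →
        ∫⁻ ω in B ∩ (fun ω => (S.arm t ω, observation S.arm t ω)) ⁻¹' V, D (t + 1) ω ∂ν.law
          = ν'.law (B ∩ (fun ω => (S.arm t ω, observation S.arm t ω)) ⁻¹' V) := by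
      intro B hB V hV
      have hVa : ∀ a : Fin 2, MeasurableSet {x : ℝ | (a, x) ∈ V} := fun a =>
        measurable_prodMk_left hV
      have hX : Measurable (fun ω => (S.arm t ω, observation S.arm t ω)) :=
        (S.measurable_arm t).prodMk (measurable_observation (S.measurable_arm t))
      have hS := (hle t _ hB).inter (hX hV)
      have h1 := S.lintegral_mul_observation ν t (f := B.indicator (D t))
        ((hDm t).indicator hB)
        (g := fun a => {x : ℝ | (a, x) ∈ V}.indicator
          fun x => ENNReal.ofReal (Real.exp (-l a x)))
        (fun a => ((hl a).neg.exp.ennreal_ofReal).indicator (hVa a))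
      have h2 := S.lintegral_mul_observation ν' t (f := B.indicator fun _ => 1)
        (measurable_const.indicator hB)
        (g := fun a => {x : ℝ | (a, x) ∈ V}.indicator fun _ => 1)
        (fun a => measurable_const.indicator (hVa a))
      have e1 : ∀ ω, (B ∩ (fun ω => (S.arm t ω, observation S.arm t ω)) ⁻¹' V).indicator
          (D (t + 1)) ω = B.indicator (D t) ω * {x : ℝ | (S.arm t ω, x) ∈ V}.indicator
          (fun x => ENNReal.ofReal (Real.exp (-l (S.arm t ω) x)))
            (observation S.arm t ω) := fun ω => by
        by_cases hω : ω ∈ B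
        · by_cases hω' : (S.arm t ω, observation S.arm t ω) ∈ V
          · simp [hω, hω', hD, SamplingRule.cumulated, Finset.sum_range_succ, Real.exp_add,
              ENNReal.ofReal_mul (Real.exp_pos _).le, mul_comm]
          · simp [hω']
        · simp [hω]
      have e2 : ∀ ω, (B ∩ (fun ω => (S.arm t ω, observation S.arm t ω)) ⁻¹' V).indicator
          (fun _ => (1 : ℝ≥0∞)) ω = B.indicator (fun _ => 1) ω *
          {x : ℝ | (S.arm t ω, x) ∈ V}.indicator (fun _ => 1)
            (observation S.arm t ω) := fun ω => by
        by_cases hω : ω ∈ B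
        · by_cases hω' : (S.arm t ω, observation S.arm t ω) ∈ V
          · simp [hω, hω']
          · simp [hω']
        · simp [hω]
      rw [← lintegral_indicator hS, ← lintegral_indicator_one hS]
      simp only [e1]
      rw [h1]
      refine Eq.trans ?_ (h2.symm.trans (lintegral_congr fun ω => (e2 ω).symm))
      refine Finset.sum_congr rfl fun a _ => ?_
      have hAB : MeasurableSet[S.filtration t] ({ω | S.arm t ω = a} ∩ B) :=
        (S.measurableSet_arm_eq t a).inter hB
      congr 1
      · rw [setLIntegral_indicator (hle t _ hB), setLIntegral_indicator (hle t _ hB),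
          Set.inter_comm, ih hAB, setLIntegral_one]
      · rw [lintegral_indicator (hVa a), lintegral_indicator (hVa a), setLIntegral_one, hd a,
          withDensity_apply _ (hVa a)]
    have huniv : ∫⁻ ω, D (t + 1) ω ∂ν.law = 1 := by
      simpa using hstep Set.univ MeasurableSet.univ Set.univ MeasurableSet.univ
    have := isFiniteMeasure_withDensity (μ := ν.law) (f := D (t + 1)) (by simp [huniv])
    have hext := ext_of_generate_finite
      (μ := (ν.law.withDensity (D (t + 1))).trim (hle (t + 1)))
      (ν := (ν'.law).trim (hle (t + 1))) _ (S.filtration_succ t)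
      (isPiSystem_inter_preimage _ _) (by
        rintro s ⟨B, hB, V, hV, rfl⟩
        have hm : MeasurableSet[S.filtration (t + 1)]
            (B ∩ (fun ω => (S.arm t ω, observation S.arm t ω)) ⁻¹' V) := by
          rw [S.filtration_succ t]
          exact MeasurableSpace.measurableSet_generateFrom ⟨B, hB, V, hV, rfl⟩
        rw [trim_measurableSet_eq _ hm, trim_measurableSet_eq _ hm,
          withDensity_apply _ (hle _ _ hm), hstep B hB V hV])
      (by
        rw [trim_measurableSet_eq _ MeasurableSet.univ, trim_measurableSet_eq _ MeasurableSet.univ,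
          withDensity_apply _ MeasurableSet.univ, Measure.restrict_univ, huniv, measure_univ])
    have h := congrArg (fun μ : @Measure Draws (S.filtration (t + 1)) => μ B) hext
    simp only [trim_measurableSet_eq _ hB, withDensity_apply _ (hle _ _ hB)] at h
    exact h

/-! ### Likelihood ratio and Wald's inequality at the stopping time -/

namespace Strategy

variable {M : Set Model}

theorem measurable_tau (S : Strategy M) : Measurable S.tau := by
  refine measurable_to_countable' fun k => ?_
  induction k using ENat.recTopCoe with
  | top =>
    have : S.tau ⁻¹' {⊤} = (⋃ k : ℕ, {ω | S.tau ω = k})ᶜ := by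
      ext ω
      simp only [Set.mem_preimage, Set.mem_singleton_iff, Set.mem_compl_iff, Set.mem_iUnion,
        Set.mem_ofPred_eq, not_exists]
      constructor
      · intro h k
        rw [h]
        exact ENat.top_ne_natCast k
      · intro h
        by_contra hne
        exact h (S.tau ω).toNat (ENat.natCast_toNat hne).symm
    rw [this]
    exact (MeasurableSet.iUnion fun k => S.filtration.le k _
      (S.isStoppingTime.measurableSet_eq k)).compl
  | coe k => exact S.filtration.le k _ (S.isStoppingTime.measurableSet_eq k)

theorem coe_tau_eq_tsum (S : Strategy M) (ω : Draws) :
    (S.tau ω : ℝ≥0∞) = ∑' s : ℕ, {ω | (s : ℕ∞) < S.tau ω}.indicator 1 ω := by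
  simp only [Set.indicator_apply, Set.mem_ofPred_eq, Pi.one_apply]
  by_cases h : S.tau ω = ⊤
  · simp [h]
  · obtain ⟨n, hn⟩ := ENat.ne_top_iff_exists.1 h
    rw [← hn, tsum_eq_sum (s := Finset.range n)]
    · rw [Finset.sum_congr rfl fun s hs => if_pos (Nat.cast_lt.2 (Finset.mem_range.1 hs))]
      simp
    · intro s hs
      exact if_neg (fun hlt => hs (Finset.mem_range.2 (Nat.cast_lt.1 hlt)))

theorem expectedDraws_eq_tsum (S : Strategy M) (ν : Model) :
    S.expectedDraws ν = ∑' s : ℕ, ν.law {ω | (s : ℕ∞) < S.tau ω} := by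
  have hm : ∀ s : ℕ, MeasurableSet {ω | (s : ℕ∞) < S.tau ω} := fun s =>
    S.filtration.le s _ (S.isStoppingTime.measurableSet_gt s)
  simp only [expectedDraws, coe_tau_eq_tsum]
  rw [lintegral_tsum fun s => (measurable_one.indicator (hm s)).aemeasurable]
  exact tsum_congr fun s => lintegral_indicator_one (hm s)

/-- **Wald's inequality** for adaptively chosen arms. -/
theorem lintegral_tsum_observation_le (S : Strategy M) (ν : Model) {g : Fin 2 → ℝ → ℝ≥0∞}
    (hg : ∀ a, Measurable (g a)) {c : ℝ≥0∞} (hc : ∀ a, ∫⁻ x, g a x ∂(ν a : Measure ℝ) ≤ c) :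
    ∫⁻ ω, ∑' s : ℕ, {ω | (s : ℕ∞) < S.tau ω}.indicator 1 ω *
        g (S.arm s ω) (observation S.arm s ω) ∂ν.law ≤ c * S.expectedDraws ν := by
  have hm : ∀ s : ℕ, MeasurableSet[S.filtration s] {ω | (s : ℕ∞) < S.tau ω} :=
    S.isStoppingTime.measurableSet_gt
  have hf : ∀ s : ℕ, Measurable[S.filtration s]
      ({ω | (s : ℕ∞) < S.tau ω}.indicator (1 : Draws → ℝ≥0∞)) := fun s =>
    measurable_const.indicator (hm s)
  rw [lintegral_tsum fun s => (((hf s).mono (S.filtration.le s) le_rfl).fun_mul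
    ((S.measurable_step hg s.lt_succ_self).mono (S.filtration.le _) le_rfl)).aemeasurable,
    expectedDraws_eq_tsum, ← ENNReal.tsum_mul_left]
  refine ENNReal.tsum_le_tsum fun s => ?_
  rw [S.lintegral_mul_observation ν s (hf s) hg]
  calc ∑ a, (∫⁻ ω in {ω | S.arm s ω = a}, {ω | (s : ℕ∞) < S.tau ω}.indicator 1 ω ∂ν.law)
        * ∫⁻ x, g a x ∂(ν a : Measure ℝ)
      ≤ ∑ a, (∫⁻ ω in {ω | S.arm s ω = a}, {ω | (s : ℕ∞) < S.tau ω}.indicator 1 ω ∂ν.law) * c :=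
        Finset.sum_le_sum fun a _ => mul_le_mul_right (hc a) _
    _ = c * ν.law {ω | (s : ℕ∞) < S.tau ω} := by
        rw [← Finset.sum_mul, mul_comm]
        congr 1
        have h := S.lintegral_mul_observation ν s (hf s) (g := fun _ _ => 1)
          (fun _ => measurable_const)
        simp only [mul_one, lintegral_const, measure_univ] at h
        rw [← h, lintegral_indicator_one (S.filtration.le s _ (hm s))]

/-- The rewards cumulated when the strategy stops. -/
noncomputable def stoppedSum (S : Strategy M) (l : Fin 2 → ℝ → ℝ) (ω : Draws) : ℝ :=
  S.cumulated l (S.tau ω).toNat ω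

theorem measurable_stoppedSum (S : Strategy M) {l : Fin 2 → ℝ → ℝ} (hl : ∀ a, Measurable (l a)) :
    Measurable (S.stoppedSum l) := by
  have h : Measurable (fun x : ℕ × Draws => S.cumulated l x.1 x.2) :=
    measurable_from_prod_countable_right fun t =>
      (S.measurable_cumulated hl t).mono (S.filtration.le t) le_rfl
  exact h.comp (((measurable_of_countable ENat.toNat).comp S.measurable_tau).prodMk measurable_id)

/-- The likelihood ratio of two bandit models at the stopping time. -/
theorem setLIntegral_exp_neg_stoppedSum_le (S : Strategy M) {ν ν' : Model} (hν : ν ∈ M)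
    {l : Fin 2 → ℝ → ℝ} (hl : ∀ a, Measurable (l a))
    (hd : ∀ a, (ν' a : Measure ℝ)
      = (ν a : Measure ℝ).withDensity fun x => ENNReal.ofReal (Real.exp (-l a x)))
    {E : Set Draws} (hE : MeasurableSet[S.isStoppingTime.measurableSpace] E) :
    ∫⁻ ω in E, ENNReal.ofReal (Real.exp (-S.stoppedSum l ω)) ∂ν.law ≤ ν'.law E := by
  have hk : ∀ k : ℕ, MeasurableSet[S.filtration k] (E ∩ {ω | S.tau ω = k}) := fun k =>
    (S.isStoppingTime.measurableSet_inter_eq_iff E k).1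
      (hE.inter (S.isStoppingTime.measurableSet_eq' k))
  have hkm : ∀ k : ℕ, MeasurableSet (E ∩ {ω | S.tau ω = k}) := fun k =>
    S.filtration.le k _ (hk k)
  have hdisj : Pairwise (Function.onFun Disjoint fun k : ℕ => E ∩ {ω | S.tau ω = k}) := by
    intro i j hij
    refine Set.disjoint_left.2 fun ω hi hj => hij ?_
    exact Nat.cast_injective (R := ℕ∞) (hi.2.symm.trans hj.2)
  have hae : E =ᵐ[ν.law] ⋃ k : ℕ, E ∩ {ω | S.tau ω = k} := by
    filter_upwards [S.tau_finite ν hν] with ω hω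
    refine propext ⟨fun h => ?_, fun h => ?_⟩
    · exact Set.mem_iUnion.2 ⟨(S.tau ω).toNat, h, (ENat.natCast_toNat hω.ne).symm⟩
    · exact (Set.mem_iUnion.1 h).choose_spec.1
  rw [setLIntegral_congr hae, lintegral_iUnion hkm hdisj]
  calc ∑' k : ℕ, ∫⁻ ω in E ∩ {ω | S.tau ω = k},
        ENNReal.ofReal (Real.exp (-S.stoppedSum l ω)) ∂ν.law
      = ∑' k : ℕ, ν'.law (E ∩ {ω | S.tau ω = k}) := by
        refine tsum_congr fun k => ?_
        rw [← S.setLIntegral_exp_neg_cumulated hl hd k (hk k)]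
        refine setLIntegral_congr_fun (hkm k) fun ω hω => ?_
        have : S.tau ω = k := hω.2
        simp only [stoppedSum, this, ENat.toNat_natCast]
    _ = ν'.law (⋃ k : ℕ, E ∩ {ω | S.tau ω = k}) := (measure_iUnion hdisj hkm).symm
    -- Only an inequality: the stopping time is not assumed to be finite under `ν'`.
    _ ≤ ν'.law E := measure_mono (Set.iUnion_subset fun k => Set.inter_subset_left)

/-- Shifting the increments by K makes them nonnegative, so the stopped sum becomes a series that
can be integrated termwise in [0, ∞], as Wald's inequality requires. -/
theorem ofReal_stoppedSum_add (S : Strategy M) {l : Fin 2 → ℝ → ℝ} {K : ℝ}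
    (hK : ∀ a x, 0 ≤ l a x + K) {ω : Draws} (hω : S.tau ω < ⊤) :
    ENNReal.ofReal (S.stoppedSum l ω + K * (S.tau ω).toNat)
      = ∑' s : ℕ, {ω | (s : ℕ∞) < S.tau ω}.indicator 1 ω *
        ENNReal.ofReal (l (S.arm s ω) (observation S.arm s ω) + K) := by
  obtain ⟨n, hn⟩ := ENat.ne_top_iff_exists.1 hω.ne
  rw [tsum_eq_sum (s := Finset.range n)]
  · have h1 : S.stoppedSum l ω + K * (S.tau ω).toNat
        = ∑ s ∈ Finset.range n, (l (S.arm s ω) (observation S.arm s ω) + K) := by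
      rw [Finset.sum_add_distrib, stoppedSum, ← hn]
      simp [SamplingRule.cumulated, mul_comm]
    rw [h1, ENNReal.ofReal_sum_of_nonneg fun s _ => hK _ _]
    refine Finset.sum_congr rfl fun s hs => ?_
    rw [Set.indicator_of_mem, Pi.one_apply, one_mul]
    change (s : ℕ∞) < S.tau ω
    rw [← hn]
    exact Nat.cast_lt.2 (Finset.mem_range.1 hs)
  · intro s hs
    rw [Set.indicator_of_notMem, zero_mul]
    intro hlt
    change (s : ℕ∞) < S.tau ω at hlt
    rw [← hn] at hlt
    exact hs (Finset.mem_range.2 (Nat.cast_lt.1 hlt))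

/-- A strategy that identifies the best arm both under `ν` and under a model `ν'` with another best
arm needs a number of draws inversely proportional to the divergence of `ν` from `ν'`. -/
theorem IsPAC.ofReal_le_expectedDraws {S : Strategy M} {δ : ℝ} (hS : S.IsPAC δ)
    (hδ : δ ∈ Set.Ioo (0 : ℝ) 1) {ν ν' : Model} (hν : ν ∈ M) (hν' : ν' ∈ M)
    (hbest : ∀ a, ν.IsBestArm a → ¬ ν'.IsBestArm a)
    {l : Fin 2 → ℝ → ℝ} (hl : ∀ a, Measurable (l a))
    (hd : ∀ a, (ν' a : Measure ℝ)
      = (ν a : Measure ℝ).withDensity fun x => ENNReal.ofReal (Real.exp (-l a x)))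
    {K : ℝ} (hK : ∀ a x, 0 ≤ l a x + K) {c : ℝ} (hc : 0 < c) (hK0 : 0 ≤ K)
    (hint : ∀ a, Integrable (l a) (ν a : Measure ℝ))
    (hkl : ∀ a, ∫ x, l a x ∂(ν a : Measure ℝ) ≤ c) :
    ENNReal.ofReal ((1 + Real.log (1 / δ)) * (1 - δ))
      ≤ 2 + ENNReal.ofReal c * S.expectedDraws ν := by
  -- Finiteness is needed at the end, to cancel the shift K E[τ].
  by_cases hfin : S.expectedDraws ν = ⊤
  · rw [hfin, ENNReal.mul_top (by simpa using hc)]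
    simp
  have hδ0 := hδ.1
  set y := Real.log (1 / δ) with hy
  have hy0 : 0 ≤ y := Real.log_nonneg (by rw [le_div_iff₀ hδ0]; linarith [hδ.2])
  have hexpy : Real.exp y = δ⁻¹ := by rw [hy, Real.exp_log (by positivity), one_div]
  set E : Set Draws := {ω | ν.IsBestArm (S.recommend ω)} with hEdef
  have hE : MeasurableSet[S.isStoppingTime.measurableSpace] E :=
    S.measurable_recommend (MeasurableSet.of_discrete (s := {a | ν.IsBestArm a}))
  have hEm : MeasurableSet E := S.isStoppingTime.measurableSpace_le _ hE
  have hPE : ENNReal.ofReal (1 - δ) ≤ ν.law E := hS ν hν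
  have hPE' : ν'.law E ≤ ENNReal.ofReal δ := by
    have h1 : ν'.law Eᶜ ≥ ENNReal.ofReal (1 - δ) :=
      (hS ν' hν').trans (measure_mono fun ω hω hωE => hbest _ hωE hω)
    have h2 := prob_add_prob_compl (μ := ν'.law) hEm
    have h3 : ν'.law E + ENNReal.ofReal (1 - δ) ≤ 1 := h2 ▸ add_le_add_right h1 _
    have h4 := ENNReal.le_sub_of_add_le_right ENNReal.ofReal_ne_top h3
    rwa [← ENNReal.ofReal_one, ← ENNReal.ofReal_sub _ (by linarith [hδ.2]), sub_sub_cancel] at h4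
  set D : Draws → ℝ≥0∞ := fun ω => ENNReal.ofReal (Real.exp (-S.stoppedSum l ω)) with hD
  have hDm : Measurable D := ((S.measurable_stoppedSum hl).neg.exp).ennreal_ofReal
  set W : Draws → ℝ≥0∞ := fun ω => ∑' s : ℕ, {ω | (s : ℕ∞) < S.tau ω}.indicator 1 ω *
    ENNReal.ofReal (l (S.arm s ω) (observation S.arm s ω) + K) with hW
  have hτm : Measurable fun ω => (S.tau ω : ℝ≥0∞) :=
    (measurable_of_countable fun n : ℕ∞ => (n : ℝ≥0∞)).comp S.measurable_tau
  have hWint : ∫⁻ ω, W ω ∂ν.law ≤ ENNReal.ofReal (c + K) * S.expectedDraws ν := by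
    refine S.lintegral_tsum_observation_le ν
      (g := fun a x => ENNReal.ofReal (l a x + K))
      (fun a => ((hl a).add_const K).ennreal_ofReal) fun a => ?_
    have hi : Integrable (fun x => l a x + K) (ν a : Measure ℝ) :=
      (hint a).add (integrable_const K)
    rw [← ofReal_integral_eq_lintegral_ofReal hi (ae_of_all _ (hK a))]
    refine ENNReal.ofReal_le_ofReal ?_
    rw [integral_add (hint a) (integrable_const K)]
    simpa using hkl a
  -- With Z the stopped log-likelihood ratio, this is 1 + u ≤ e^(u-Z) + Z shifted by Kτ, for u =
  -- log(1/δ) on E and u = 0 off E, where the left-hand constant is dropped. The factor e^u = 1/δ on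
  -- E compensates `ν'.law E ≤ δ`, so the two exponential terms integrate to at most 1 each.
  have hpt : ∀ᵐ ω ∂ν.law, E.indicator (fun _ => ENNReal.ofReal (1 + y)) ω
        + ENNReal.ofReal K * (S.tau ω : ℝ≥0∞)
      ≤ (ENNReal.ofReal δ⁻¹ * E.indicator D ω + Eᶜ.indicator D ω) + W ω := by
    filter_upwards [S.tau_finite ν hν] with ω hω
    rw [hW]
    simp only
    rw [← S.ofReal_stoppedSum_add hK hω]
    have hτ : (S.tau ω : ℝ≥0∞) = ENNReal.ofReal ((S.tau ω).toNat : ℝ) := by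
      obtain ⟨n, hn⟩ := ENat.ne_top_iff_exists.1 hω.ne
      rw [← hn]
      simp
    rw [hτ, ← ENNReal.ofReal_mul hK0]
    set n : ℝ := ((S.tau ω).toNat : ℝ)
    set Z := S.stoppedSum l ω with hZ
    have hn0 : 0 ≤ K * n := by positivity
    have key : ∀ u : ℝ, 0 ≤ u → ENNReal.ofReal (1 + u) + ENNReal.ofReal (K * n)
        ≤ ENNReal.ofReal (Real.exp (u - Z)) + ENNReal.ofReal (Z + K * n) := fun u hu => by
      rw [← ENNReal.ofReal_add (by linarith) hn0]
      refine le_trans (ENNReal.ofReal_le_ofReal ?_) ENNReal.ofReal_add_le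
      linarith [Real.add_one_le_exp (u - Z)]
    by_cases h : ω ∈ E
    · simp only [Set.indicator_of_mem h, Set.indicator_of_notMem (Set.notMem_compl_iff.2 h),
        add_zero, hD]
      rw [← ENNReal.ofReal_mul (by positivity), ← hexpy, ← Real.exp_add, ← sub_eq_add_neg]
      exact key y hy0
    · simp only [Set.indicator_of_notMem h, Set.indicator_of_mem (Set.mem_compl h), hD, mul_zero,
        zero_add]
      refine le_trans ?_ ((key 0 le_rfl).trans (by rw [zero_sub]))
      exact le_add_self
  have hmain := lintegral_mono_ae hpt
  rw [lintegral_add_left (measurable_const.indicator hEm), lintegral_indicator_const hEm,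
    lintegral_const_mul _ hτm,
    lintegral_add_left (((hDm.indicator hEm).const_mul _).fun_add (hDm.indicator hEm.compl)),
    lintegral_add_left ((hDm.indicator hEm).const_mul _),
    lintegral_const_mul _ (hDm.indicator hEm), lintegral_indicator hEm,
    lintegral_indicator hEm.compl] at hmain
  have hD1 : ENNReal.ofReal δ⁻¹ * ∫⁻ ω in E, D ω ∂ν.law ≤ 1 :=
    calc ENNReal.ofReal δ⁻¹ * ∫⁻ ω in E, D ω ∂ν.law
        ≤ ENNReal.ofReal δ⁻¹ * ENNReal.ofReal δ := by
          gcongr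
          exact (S.setLIntegral_exp_neg_stoppedSum_le hν hl hd hE).trans hPE'
      _ = 1 := by
          rw [← ENNReal.ofReal_mul (by positivity), inv_mul_cancel₀ hδ0.ne', ENNReal.ofReal_one]
  have hD2 : ∫⁻ ω in Eᶜ, D ω ∂ν.law ≤ 1 :=
    (S.setLIntegral_exp_neg_stoppedSum_le hν hl hd hE.compl).trans prob_le_one
  have hKfin : ENNReal.ofReal K * S.expectedDraws ν ≠ ⊤ :=
    ENNReal.mul_ne_top ENNReal.ofReal_ne_top hfin
  have hfinal : ENNReal.ofReal (1 + y) * ν.law E + ENNReal.ofReal K * S.expectedDraws ν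
      ≤ (2 + ENNReal.ofReal c * S.expectedDraws ν) + ENNReal.ofReal K * S.expectedDraws ν :=
    calc _ ≤ _ := hmain
      _ ≤ (1 + 1) + ENNReal.ofReal (c + K) * S.expectedDraws ν := by gcongr
      _ = _ := by
          rw [ENNReal.ofReal_add hc.le hK0, add_mul, one_add_one_eq_two, add_assoc]
  calc ENNReal.ofReal ((1 + y) * (1 - δ))
      = ENNReal.ofReal (1 + y) * ENNReal.ofReal (1 - δ) := ENNReal.ofReal_mul (by linarith)
    _ ≤ ENNReal.ofReal (1 + y) * ν.law E := by gcongr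
    _ ≤ _ := (ENNReal.add_le_add_iff_right hKfin).1 hfinal

end Strategy

/-! ### The limit of small risk -/

/-- After division by log(1/δ) the additive constants vanish in the limit and the factor 1 - δ tends
to 1, which leaves 1/c. -/
theorem ofReal_inv_le_fixedConfidenceComplexity {M : Set Model} {ν : Model} {c : ℝ} (hc : 0 < c)
    (h : ∀ S : Strategy M, ∀ δ ∈ Set.Ioo (0 : ℝ) 1, S.IsPAC δ →
      ENNReal.ofReal ((1 + Real.log (1 / δ)) * (1 - δ))
        ≤ 2 + ENNReal.ofReal c * S.expectedDraws ν) :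
    (ENNReal.ofReal c)⁻¹ ≤ fixedConfidenceComplexity M ν := by
  refine le_iInf fun P => ?_
  have hlog : Tendsto (fun δ : ℝ => Real.log (1 / δ)) (𝓝[>] 0) atTop := by
    simp only [one_div]
    exact Real.tendsto_log_atTop.comp tendsto_inv_nhdsGT_zero
  have hlim : Tendsto (fun δ : ℝ => ENNReal.ofReal
      (((1 - δ) - (1 + δ) / Real.log (1 / δ)) / c)) (𝓝[>] 0) (𝓝 (ENNReal.ofReal c)⁻¹) := by
    rw [← ENNReal.ofReal_inv_of_pos hc]
    refine ENNReal.tendsto_ofReal ?_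
    have h0 : Tendsto (fun δ : ℝ => δ) (𝓝[>] 0) (𝓝 0) :=
      tendsto_nhdsWithin_of_tendsto_nhds tendsto_id
    have h1 : Tendsto (fun δ : ℝ => (1 + δ) / Real.log (1 / δ)) (𝓝[>] 0) (𝓝 0) :=
      (h0.const_add 1).div_atTop hlog
    simpa using ((h0.const_sub 1).sub h1).div_const c
  rw [← hlim.limsup_eq]
  refine limsup_le_limsup ?_
  filter_upwards [Ioo_mem_nhdsGT (one_pos : (0 : ℝ) < 1), hlog.eventually_gt_atTop 0] with δ hδ hy
  have hS := h (P.strategy δ) δ hδ (P.isPAC δ hδ)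
  rw [ENNReal.le_div_iff_mul_le (Or.inl (by simpa using hy)) (Or.inl ENNReal.ofReal_ne_top),
    ← ENNReal.ofReal_mul' hy.le]
  have e : ((1 - δ) - (1 + δ) / Real.log (1 / δ)) / c * Real.log (1 / δ)
      = ((1 + Real.log (1 / δ)) * (1 - δ) - 2) / c := by
    field_simp
    ring
  rw [e, ENNReal.ofReal_div_of_pos hc, ENNReal.ofReal_sub _ (by norm_num)]
  refine ENNReal.div_le_of_le_mul' (tsub_le_iff_left.2 ?_)
  simpa using hS

/-! ### Bernoulli models -/

/-- The log-likelihood ratio of two Bernoulli distributions with means `p` and `q`. -/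
noncomputable def bernoulliLLR (p q x : ℝ) : ℝ :=
  if x = 1 then Real.log (p / q) else Real.log ((1 - p) / (1 - q))

theorem measurable_bernoulliLLR (p q : ℝ) : Measurable (bernoulliLLR p q) :=
  Measurable.ite (measurableSet_singleton 1) measurable_const measurable_const

theorem withDensity_bernoulliLLR {p q : unitInterval} (hp : (p : ℝ) ∈ Set.Ioo 0 1)
    (hq : (q : ℝ) ∈ Set.Ioo 0 1) :
    (bernoulli q : Measure ℝ) = (bernoulli p : Measure ℝ).withDensity
      fun x => ENNReal.ofReal (Real.exp (-bernoulliLLR p q x)) := by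
  have hp0 := hp.1
  have hq0 := hq.1
  have hp1 : (0 : ℝ) < 1 - p := sub_pos.2 hp.2
  have hq1 : (0 : ℝ) < 1 - q := sub_pos.2 hq.2
  ext s hs
  rw [withDensity_apply _ hs, ← lintegral_indicator hs, ← lintegral_indicator_one hs,
    lintegral_bernoulli, lintegral_bernoulli]
  have e1 : ENNReal.ofReal p * ENNReal.ofReal (Real.exp (-Real.log (p / q)))
      = ENNReal.ofReal q := by
    rw [← ENNReal.ofReal_mul hp0.le, Real.exp_neg, Real.exp_log (by positivity)]
    congr 1
    field_simp
  have e2 : ENNReal.ofReal (1 - p) * ENNReal.ofReal (Real.exp (-Real.log ((1 - p) / (1 - q))))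
      = ENNReal.ofReal (1 - q) := by
    rw [← ENNReal.ofReal_mul hp1.le, Real.exp_neg, Real.exp_log (by positivity)]
    congr 1
    field_simp
  by_cases h1 : (1 : ℝ) ∈ s <;> by_cases h0 : (0 : ℝ) ∈ s <;>
    simp [h1, h0, bernoulliLLR, e1, e2]

theorem integral_bernoulliLLR (p q : unitInterval) :
    ∫ x, bernoulliLLR p q x ∂(bernoulli p : Measure ℝ) = bernoulliKL p q := by
  simp [integral_bernoulli, bernoulliLLR, bernoulliKL]

theorem inv_le_fixedConfidenceComplexity_bernoulli {p p' : Fin 2 → unitInterval}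
    (hp : ∀ i, (p i : ℝ) ∈ Set.Ioo 0 1) (hp' : ∀ i, (p' i : ℝ) ∈ Set.Ioo 0 1) {a b : Fin 2}
    (hba : p b < p a) (hab : p' a < p' b) {c : ℝ} (hc : 0 < c)
    (hkl : ∀ i, bernoulliKL (p i) (p' i) ≤ c) :
    (ENNReal.ofReal c)⁻¹
      ≤ fixedConfidenceComplexity bernoulliModels (fun i => bernoulli (p i)) := by
  refine ofReal_inv_le_fixedConfidenceComplexity hc fun S δ hδ hS => ?_
  have hK : ∃ K, 0 ≤ K ∧ ∀ i x, 0 ≤ bernoulliLLR (p i) (p' i) x + K := by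
    -- The log-likelihood ratio takes only two values on the whole line, so it is bounded everywhere
    -- and not just on {0, 1}.
    refine ⟨∑ i, (|Real.log (p i / p' i)| + |Real.log ((1 - p i) / (1 - p' i))|),
      by positivity, fun i x => ?_⟩
    have h := Finset.single_le_sum (f := fun i =>
      |Real.log (p i / p' i)| + |Real.log ((1 - p i) / (1 - p' i))|)
      (fun i _ => by positivity) (Finset.mem_univ i)
    have h1 := neg_abs_le (Real.log (p i / p' i))
    have h2 := neg_abs_le (Real.log ((1 - p i) / (1 - p' i)))
    have h3 := abs_nonneg (Real.log (p i / p' i))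
    have h4 := abs_nonneg (Real.log ((1 - p i) / (1 - p' i)))
    simp only [bernoulliLLR] at h ⊢
    split_ifs <;> linarith
  obtain ⟨K, hK0, hK⟩ := hK
  refine hS.ofReal_le_expectedDraws hδ
    ((mem_bernoulliModels_iff _).2 ⟨p, hp, ⟨a, b, hba⟩, rfl⟩)
    ((mem_bernoulliModels_iff (fun i => bernoulli (p' i))).2 ⟨p', hp', ⟨b, a, hab⟩, rfl⟩)
    (fun d hd hd' => ?_)
    (l := fun i => bernoulliLLR (p i) (p' i)) (fun _ => measurable_bernoulliLLR _ _)
    (fun i => withDensity_bernoulliLLR (hp i) (hp' i)) hK hc hK0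
    (fun i => integrable_bernoulli _ _) (fun i => (integral_bernoulliLLR _ _).trans_le (hkl i))
  rw [isBestArm_bernoulli_iff hba] at hd
  rw [isBestArm_bernoulli_iff hab] at hd'
  rw [← hd, ← hd'] at hba
  exact lt_irrefl _ hba

end TwoArmedBandit

/-! ### The strict inequality -/

theorem proposition2 (ν : TwoArmedBandit.Model) (hν : ν ∈ TwoArmedBandit.bernoulliModels) :
    TwoArmedBandit.fixedBudgetComplexity TwoArmedBandit.bernoulliModels ν <
      TwoArmedBandit.fixedConfidenceComplexity TwoArmedBandit.bernoulliModels ν := by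
  obtain ⟨p, hp, ⟨a, b, hba⟩, rfl⟩ := (TwoArmedBandit.mem_bernoulliModels_iff ν).1 hν
  obtain ⟨c, hc, hcB, x, hx, y, hy, hxy, hkx, hky⟩ :=
    TwoArmedBandit.exists_separated_bernoulliKL_lt (hp a) (hp b) hba
  have hab : b ≠ a := by rintro rfl; exact lt_irrefl _ hba
  set x' : unitInterval := ⟨x, hx.1.le, hx.2.le⟩
  set y' : unitInterval := ⟨y, hy.1.le, hy.2.le⟩
  -- In the alternative model the best arm a receives the smaller mean x and the other arm the
  -- larger mean y.
  refine (TwoArmedBandit.fixedBudgetComplexity_bernoulli_le hp hba).trans_lt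
    (lt_of_lt_of_le ?_ (TwoArmedBandit.inv_le_fixedConfidenceComplexity_bernoulli hp
      (p' := fun i => if i = a then x' else y') (fun i => ?_) hba (c := c) ?_ hc fun i => ?_))
  · exact ENNReal.inv_lt_inv.2 ((ENNReal.ofReal_lt_ofReal_iff (hc.trans hcB)).2 hcB)
  · split_ifs
    exacts [hx, hy]
  · simp only [if_true, if_neg hab]
    exact hxy
  · split_ifs with h
    · rw [h]
      exact hkx
    · obtain rfl : i = b := by omega
      exact hky
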